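/- Let $G=([n],E)$ be a natural unit interval graph, that is, a simple graph such that for every edge $\{i,j\}\in E$ with $i<j$ and every $k$ with $i<k<j$, both $\{i,k\}\in E$ and $\{k,j\}\in E$. Let $\mathcal A_G$ be the arrangement in $\mathbb R^n$ of the hyperplanes $x_i=x_j$, $\{i,j\}\in E$, and let $R$ be a region of $\mathcal A_G$ (a connected component of the complement of the union of the hyperplanes). Let $S_R$ be the set of permutations $\sigma=\sigma_1\cdots\sigma_n$ of $[n]$ for which the braid region $\{x\in\mathbb R^n : x_{\sigma_1}>x_{\sigma_2}>\dots>x_{\sigma_n}\}$ is contained in $R$. Then $S_R$ has a lexicographically smallest element $\sigma$ (in one-line notation), and $\sigma$ is the unique element of $S_R$ all of whose descents are edges of $G$, i.e. such that $\sigma_i>\sigma_{i+1}$ implies $\{\sigma_i,\sigma_{i+1}\}\in E$. Moreover, for every $v\in\mathbb R^n$ with $v_n>0$ and $v_i>(6n^2+1)\,v_{i+1}$ for all $1\le i<n$, $$\mathrm{pd}_v(R)=\mathrm{RLmin}(\sigma).$$ Here $\mathrm{RLmin}(\sigma)$ is the number of right-to-left minima of $\sigma$, i.e. of indices $i$ with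 $\sigma_i<\sigma_j$ for all $j>i$. The projection dimension $\mathrm{pd}_v(R)$ is the dimension of the unique face of $R$ that contains in its relative interior the unique point of $\overline R$ nearest to $v$ in Euclidean distance, the faces of $R$ being the non-empty intersections of $\overline R$ with intersections of (possibly no) hyperplanes of $\mathcal A_G$. -/

import Mathlib

/-- A set of affine subspaces of `ℝⁿ` is used as a hyperplane arrangement. -/
abbrev Arrangement (n : ℕ) : Type := Set (AffineSubspace ℝ (EuclideanSpace ℝ (Fin n)))

namespace Arrangement

variable {n : ℕ}

/-- The complement of the union of the hyperplanes of the arrangement. -/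
def compl (A : Arrangement n) : Set (EuclideanSpace ℝ (Fin n)) :=
  {x | ∀ H ∈ A, x ∉ H}

/-- A region: a connected component of the complement of the union of the hyperplanes. -/
def IsRegion (A : Arrangement n) (R : Set (EuclideanSpace ℝ (Fin n))) : Prop :=
  ∃ x ∈ A.compl, R = connectedComponentIn A.compl x

/-- `F` is a (closed) face of the region `R`: a non-empty intersection of the closure of `R` with
a flat, that is, with the intersection of some (possibly no) hyperplanes of the arrangement. -/
def IsFaceOf (A : Arrangement n) (R F : Set (EuclideanSpace ℝ (Fin n))) : Prop :=
  F.Nonempty ∧ ∃ B : Set (AffineSubspace ℝ (EuclideanSpace ℝ (Fin n))),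
    B ⊆ A ∧ F = closure R ∩ ((sInf B : AffineSubspace ℝ (EuclideanSpace ℝ (Fin n))) :
      Set (EuclideanSpace ℝ (Fin n)))

end Arrangement

/-- The dimension of a subset of `ℝⁿ`, that is, of its affine span. -/
noncomputable def affineDim {n : ℕ} (F : Set (EuclideanSpace ℝ (Fin n))) : ℕ :=
  Module.finrank ℝ (affineSpan ℝ F).direction

/-- `p` is a point of (the closed region) `closure R` at minimum Euclidean distance from `v`. -/
def IsNearestPoint {n : ℕ} (v : EuclideanSpace ℝ (Fin n)) (R : Set (EuclideanSpace ℝ (Fin n)))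
    (p : EuclideanSpace ℝ (Fin n)) : Prop :=
  p ∈ closure R ∧ ∀ q ∈ closure R, dist v p ≤ dist v q

/-- The projection dimension `pd_v(R)` is well defined and equal to `d`: there is a unique point
`p` of the closed region nearest to `v`, there is a unique face of `R` containing `p` in its
relative interior, and that face has dimension `d`. -/
def HasProjDim {n : ℕ} (A : Arrangement n) (v : EuclideanSpace ℝ (Fin n))
    (R : Set (EuclideanSpace ℝ (Fin n))) (d : ℕ) : Prop :=
  ∃ p, IsNearestPoint v R p ∧ (∀ q, IsNearestPoint v R q → q = p) ∧
    ∃ F, (A.IsFaceOf R F ∧ p ∈ intrinsicInterior ℝ F) ∧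
      (∀ F', A.IsFaceOf R F' ∧ p ∈ intrinsicInterior ℝ F' → F' = F) ∧
      affineDim F = d

/-- The hyperplane `x_i - x_j = 0`. -/
noncomputable def coordHyperplane {n : ℕ} (i j : Fin n) :
    AffineSubspace ℝ (EuclideanSpace ℝ (Fin n)) :=
  (LinearMap.ker ((EuclideanSpace.proj i - EuclideanSpace.proj j :
    EuclideanSpace ℝ (Fin n) →L[ℝ] ℝ) : EuclideanSpace ℝ (Fin n) →ₗ[ℝ] ℝ)).toAffineSubspace

theorem mem_coordHyperplane {n : ℕ} (i j : Fin n) (x : EuclideanSpace ℝ (Fin n)) :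
    x ∈ coordHyperplane i j ↔ x i - x j = 0 := by
  simp [coordHyperplane]

/-- The graphical arrangement of `G`. -/
def graphicalArrangement {n : ℕ} (G : SimpleGraph (Fin n)) : Arrangement n :=
  {H | ∃ i j, i < j ∧ G.Adj i j ∧ H = coordHyperplane i j}

/-- The natural unit interval graphs on the ordered vertex set `Fin n`. -/
def IsNaturalUnitInterval {n : ℕ} (G : SimpleGraph (Fin n)) : Prop :=
  ∀ i j, i < j → G.Adj i j → ∀ k, i < k → k < j → G.Adj i k ∧ G.Adj k j

/-- The region `x_{σ 0} > x_{σ 1} > ⋯` of the braid arrangement labelled by `σ`. -/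
def braidRegion {n : ℕ} (σ : Equiv.Perm (Fin n)) : Set (EuclideanSpace ℝ (Fin n)) :=
  {x | ∀ i j, i < j → x (σ j) < x (σ i)}

/-- The permutations whose braid regions make up `R`. -/
def regionPerms {n : ℕ} (R : Set (EuclideanSpace ℝ (Fin n))) : Set (Equiv.Perm (Fin n)) :=
  {σ | braidRegion σ ⊆ R}

/-- `σ` is the smallest element of `S` for the lexicographic order on one-line notations. -/
def IsLexMin {n : ℕ} (S : Set (Equiv.Perm (Fin n))) (σ : Equiv.Perm (Fin n)) : Prop :=
  σ ∈ S ∧ ∀ τ ∈ S, toLex (σ : Fin n → Fin n) ≤ toLex (τ : Fin n → Fin n)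

/-- Every descent of `σ` is an edge of `G`. -/
def DescentsAreEdges {n : ℕ} (G : SimpleGraph (Fin n)) (σ : Equiv.Perm (Fin n)) : Prop :=
  ∀ i j : Fin n, (i : ℕ) + 1 = j → σ j < σ i → G.Adj (σ i) (σ j)

/-- The number of right-to-left minima of `σ`. -/
def rlMin {n : ℕ} (σ : Equiv.Perm (Fin n)) : ℕ :=
  (Finset.univ.filter fun i : Fin n => ∀ j, i < j → σ i < σ j).card

/-- The condition `v_i > (6n² + 1) v_{i+1}` for all `i < n`, and `v_n > 0`. -/
def IsRapidlyDecreasing {n : ℕ} (v : EuclideanSpace ℝ (Fin n)) : Prop :=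
  (∀ i j : Fin n, (i : ℕ) + 1 = j → (6 * (n : ℝ) ^ 2 + 1) * v j < v i) ∧
    ∀ i : Fin n, (i : ℕ) + 1 = n → 0 < v i

/-! A region is the open cone of one orientation of the edges of `G`, and its permutations are the
linear extensions of that orientation. Swapping the two entries of a non-edge descent stays in the
region and lowers the word, so the lexicographic minimum has only edge descents
(`IsLexMin.descentsAreEdges`). Conversely, `exists_adj_left` shows that a word with only edge
descents cannot be undercut: at the first difference, the smaller word would reverse an edge
(`DescentsAreEdges.toLex_le`).

For the projection, cut `σ` into consecutive blocks ending at its right-to-left minima; these are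
the fibres of `suffixMin σ`. The nearest point `p` averages `v` over each block. Block minima
increase from left to right and `v` drops quickly, so the averages strictly decrease and `p` lies in
the closed region. By `exists_adj_right`, every entry is joined to its block minimum by edges going
right within the block, so points of the closed region are smallest on a block at its minimum. This
gives the variational inequality `sum_sub_blockAverage_nonneg`. The face of `p` spans the space of
vectors constant on blocks, whose dimension is the number of blocks. -/

/-! ### Inversions of words whose descents are edges -/

namespace DescentsAreEdges

variable {n : ℕ} {G : SimpleGraph (Fin n)} {τ : Equiv.Perm (Fin n)}

/-- If all descents are edges, the lower end of an inversion is adjacent to some larger entry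
between the two ends. -/
theorem exists_adj_left (hG : IsNaturalUnitInterval G) (hτ : DescentsAreEdges G τ)
    {i j : Fin n} (hij : i < j) (h : τ j < τ i) :
    ∃ k, i ≤ k ∧ k < j ∧ G.Adj (τ k) (τ j) := by
  -- Take the last entry before `j` exceeding `τ j`. The next entry is `τ j` itself or below it, so
  -- the descent there is an edge spanning `τ j`.
  obtain ⟨k, hk, hmax⟩ := Set.exists_max_image {k : Fin n | i ≤ k ∧ k < j ∧ τ j < τ k} id
    (Set.toFinite _) ⟨i, le_rfl, hij, h⟩
  obtain ⟨hik, hkj, hlt⟩ := hk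
  refine ⟨k, hik, hkj, ?_⟩
  let l : Fin n := ⟨k + 1, by have := j.2; have : (k : ℕ) < j := hkj; omega⟩
  have hkl : k < l := Fin.lt_def.2 (Nat.lt_succ_self _)
  have hlj : l ≤ j := Fin.le_def.2 (Nat.succ_le_of_lt hkj)
  rcases hlj.eq_or_lt with e | hlj
  · rw [← e] at hlt ⊢
    exact hτ k l rfl hlt
  · have h1 : τ l < τ j := by
      refine lt_of_le_of_ne (not_lt.1 fun h' => ?_) (fun e => hlj.ne (τ.injective e))
      exact absurd (hmax l ⟨hik.trans hkl.le, hlj, h'⟩) (not_le.2 hkl)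
    have h2 := hτ k l rfl (h1.trans hlt)
    exact ((hG _ _ (h1.trans hlt) h2.symm _ h1 hlt).2).symm

/-- If all descents are edges, the upper end of an inversion is adjacent to some smaller entry
between the two ends. -/
theorem exists_adj_right (hG : IsNaturalUnitInterval G) (hτ : DescentsAreEdges G τ)
    {i j : Fin n} (hij : i < j) (h : τ j < τ i) :
    ∃ k, i < k ∧ k ≤ j ∧ τ k < τ i ∧ G.Adj (τ i) (τ k) := by
  obtain ⟨k, hk, hmin⟩ := Set.exists_min_image {k : Fin n | i < k ∧ k ≤ j ∧ τ k < τ i} id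
    (Set.toFinite _) ⟨j, hij, le_rfl, h⟩
  obtain ⟨hik, hkj, hlt⟩ := hk
  refine ⟨k, hik, hkj, hlt, ?_⟩
  have hik' : (i : ℕ) < k := hik
  let l : Fin n := ⟨k - 1, by have := k.2; omega⟩
  have hlk : l < k := Fin.lt_def.2 (show (k : ℕ) - 1 < k by omega)
  have hil : i ≤ l := Fin.le_def.2 (show (i : ℕ) ≤ (k : ℕ) - 1 by omega)
  have hs : (l : ℕ) + 1 = k := show (k : ℕ) - 1 + 1 = k by omega
  rcases hil.eq_or_lt with e | hil
  · rw [e] at hlt ⊢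
    exact hτ l k hs hlt
  · have h1 : τ i < τ l := by
      refine lt_of_le_of_ne (not_lt.1 fun h' => ?_) (fun e => hil.ne (τ.injective e))
      exact absurd (hmin l ⟨hil, hlk.le.trans hkj, h'⟩) (not_le.2 hlk)
    have h2 := hτ l k hs (hlt.trans h1)
    exact ((hG _ _ (hlt.trans h1) h2.symm _ hlt h1).1).symm

end DescentsAreEdges

/-! ### Regions as orientation cones, and their permutations -/

section Regions

variable {n : ℕ}

/-- The open cone of the points ordered strictly like `y` along the edges of `G`. -/
def orientationCone (G : SimpleGraph (Fin n)) (y : EuclideanSpace ℝ (Fin n)) :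
    Set (EuclideanSpace ℝ (Fin n)) :=
  {x | ∀ i j, G.Adj i j → y j < y i → x j < x i}

theorem mem_compl_graphicalArrangement {G : SimpleGraph (Fin n)} {x : EuclideanSpace ℝ (Fin n)} :
    x ∈ (graphicalArrangement G).compl ↔ ∀ i j, G.Adj i j → x i ≠ x j := by
  constructor
  · intro h i j hij e
    rcases lt_or_gt_of_ne hij.ne with hlt | hlt
    · exact h _ ⟨i, j, hlt, hij, rfl⟩ ((mem_coordHyperplane i j x).2 (sub_eq_zero.2 e))
    · exact h _ ⟨j, i, hlt, hij.symm, rfl⟩ ((mem_coordHyperplane j i x).2 (sub_eq_zero.2 e.symm))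
  · rintro h _ ⟨i, j, -, hij, rfl⟩ hx
    exact h i j hij (sub_eq_zero.1 ((mem_coordHyperplane i j x).1 hx))

theorem convex_orientationCone (G : SimpleGraph (Fin n)) (y : EuclideanSpace ℝ (Fin n)) :
    Convex ℝ (orientationCone G y) := by
  intro x hx z hz a b ha hb hab i j hij hy
  have h1 := hx i j hij hy
  have h2 := hz i j hij hy
  simp only [PiLp.add_apply, PiLp.smul_apply, smul_eq_mul]
  rcases ha.eq_or_lt with rfl | ha
  · have : b = 1 := by linarith
    subst this
    linarith
  · have := mul_lt_mul_of_pos_left h1 ha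
    have := mul_le_mul_of_nonneg_left h2.le hb
    linarith

/-- By the intermediate value theorem no edge difference changes sign on a component; conversely the
cone is convex. -/
theorem connectedComponentIn_compl_graphicalArrangement {G : SimpleGraph (Fin n)}
    {y : EuclideanSpace ℝ (Fin n)} (hy : y ∈ (graphicalArrangement G).compl) :
    connectedComponentIn (graphicalArrangement G).compl y = orientationCone G y := by
  apply Set.Subset.antisymm
  · intro x hx i j hij hlt
    by_contra hle
    have hpc : IsPreconnected (connectedComponentIn (graphicalArrangement G).compl y) :=
      isPreconnected_connectedComponentIn
    have hc : ContinuousOn (fun z : EuclideanSpace ℝ (Fin n) => z i - z j)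
        (connectedComponentIn (graphicalArrangement G).compl y) := by fun_prop
    obtain ⟨z, hz, h0⟩ := hpc.intermediate_value hx (mem_connectedComponentIn hy) hc
      (show (0 : ℝ) ∈ Set.Icc (x i - x j) (y i - y j) from
        ⟨by linarith [not_lt.1 hle], by linarith⟩)
    exact mem_compl_graphicalArrangement.1 (connectedComponentIn_subset _ _ hz) i j hij
      (sub_eq_zero.1 h0)
  · refine (convex_orientationCone G y).isPreconnected.subset_connectedComponentIn
      (fun i j _ h => h) fun x hx => mem_compl_graphicalArrangement.2 fun i j hij e => ?_
    rcases lt_or_gt_of_ne (mem_compl_graphicalArrangement.1 hy i j hij) with h | h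
    · exact (hx j i hij.symm h).ne e
    · exact (hx i j hij h).ne' e

/-- Adding a small positive multiple of `y` makes the weak inequalities strict. -/
theorem closure_orientationCone (G : SimpleGraph (Fin n)) (y : EuclideanSpace ℝ (Fin n)) :
    closure (orientationCone G y) = {x | ∀ i j, G.Adj i j → y j < y i → x j ≤ x i} := by
  apply Set.Subset.antisymm
  · refine closure_minimal (fun x hx i j hij h => (hx i j hij h).le) ?_
    simp only [Set.ofPred_forall]
    refine isClosed_iInter fun i => isClosed_iInter fun j => isClosed_iInter fun _ =>
      isClosed_iInter fun _ => isClosed_le (by fun_prop) (by fun_prop)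
  · intro x hx
    have ht : Filter.Tendsto (fun t : ℝ => x + t • y) (nhdsWithin 0 (Set.Ioi 0)) (nhds x) := by
      have : Continuous fun t : ℝ => x + t • y := by fun_prop
      simpa using (this.tendsto 0).mono_left nhdsWithin_le_nhds
    refine mem_closure_of_tendsto ht ?_
    filter_upwards [self_mem_nhdsWithin] with t ht i j hij h
    have := hx i j hij h
    have := mul_lt_mul_of_pos_left h (show (0 : ℝ) < t from ht)
    simp only [PiLp.add_apply, PiLp.smul_apply, smul_eq_mul]
    linarith

theorem mem_regionPerms_orientationCone {G : SimpleGraph (Fin n)} {y : EuclideanSpace ℝ (Fin n)}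
    {σ : Equiv.Perm (Fin n)} :
    σ ∈ regionPerms (orientationCone G y) ↔
      ∀ i j, G.Adj (σ i) (σ j) → y (σ j) < y (σ i) → i < j := by
  constructor
  · intro h i j hij hy
    -- Test point of the braid region: each coordinate is minus its position in `σ`.
    have hz : WithLp.toLp 2 (fun a => -((σ.symm a : ℕ) : ℝ)) ∈ braidRegion σ := by
      intro i j hij
      simpa using hij
    simpa using h hz _ _ hij hy
  · intro h x hx a b hab hy
    have := h (σ.symm a) (σ.symm b) (by simpa using hab) (by simpa using hy)
    simpa using hx _ _ this

theorem regionPerms_orientationCone_nonempty (G : SimpleGraph (Fin n))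
    (y : EuclideanSpace ℝ (Fin n)) : (regionPerms (orientationCone G y)).Nonempty := by
  refine ⟨Tuple.sort fun i => -y i, mem_regionPerms_orientationCone.2 fun i j _ h => ?_⟩
  by_contra hle
  have := Tuple.monotone_sort (fun i => -y i) (not_lt.1 hle)
  simp only [Function.comp_apply] at this
  linarith

variable {G : SimpleGraph (Fin n)} {y : EuclideanSpace ℝ (Fin n)}

theorem IsLexMin.descentsAreEdges {σ : Equiv.Perm (Fin n)}
    (hσ : IsLexMin (regionPerms (orientationCone G y)) σ) :
    DescentsAreEdges G σ := by
  intro i j hij hlt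
  by_contra hadj
  have hij' : i < j := Fin.lt_def.2 (by omega)
  have hmem : σ * Equiv.swap i j ∈ regionPerms (orientationCone G y) := by
    rw [mem_regionPerms_orientationCone]
    intro k l hkl hykl
    simp only [Equiv.Perm.mul_apply] at hkl hykl
    have h := mem_regionPerms_orientationCone.1 hσ.1 _ _ hkl hykl
    have hne : k ≠ l := by rintro rfl; exact lt_irrefl _ hykl
    -- The swapped positions are consecutive, so only the pair `σ i`, `σ j` changes its relative
    -- order, and it is not an edge.
    simp only [Equiv.swap_apply_def] at h hkl
    split_ifs at h hkl <;> subst_vars <;>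
      first
      | exact absurd rfl hne
      | exact absurd hkl hadj
      | exact absurd hkl.symm hadj
      | (simp only [Fin.lt_def, Fin.ext_iff] at *; omega)
  have hle := hσ.2 _ hmem
  refine absurd hle (not_le.2 ⟨i, fun k hk => ?_, ?_⟩)
  · have : Equiv.swap i j k = k := Equiv.swap_apply_of_ne_of_ne hk.ne (hk.trans hij').ne
    simp [this]
  · simpa using hlt

theorem DescentsAreEdges.toLex_le (hG : IsNaturalUnitInterval G)
    (hy : y ∈ (graphicalArrangement G).compl) {σ τ : Equiv.Perm (Fin n)}
    (hτ : DescentsAreEdges G τ) (hτR : τ ∈ regionPerms (orientationCone G y))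
    (hσR : σ ∈ regionPerms (orientationCone G y)) :
    toLex (τ : Fin n → Fin n) ≤ toLex (σ : Fin n → Fin n) := by
  rw [mem_regionPerms_orientationCone] at hτR hσR
  refine not_lt.1 ?_
  rintro ⟨i, hi, hlt⟩
  simp only [Pi.toLex_apply] at hi hlt
  -- the entry `σ i` occurs later in `τ`
  obtain ⟨j, hj⟩ := τ.surjective (σ i)
  have hij : i < j := by
    rcases lt_trichotomy i j with h | h | h
    · exact h
    · subst h; exact absurd hj hlt.ne'
    · have := hi j h
      rw [hj] at this
      exact absurd (σ.injective this) h.ne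
  -- The neighbour `τ k` precedes `σ i` in `τ` but follows it in `σ`, so the two words orient this
  -- edge differently.
  obtain ⟨k, hik, hkj, hadj⟩ := hτ.exists_adj_left hG hij (hj ▸ hlt)
  obtain ⟨l, hl⟩ := σ.surjective (τ k)
  have hil : i ≤ l := by
    by_contra h
    rw [not_le] at h
    rw [hi l h] at hl
    exact absurd (τ.injective hl) (h.trans_le hik).ne
  rcases lt_or_gt_of_ne (mem_compl_graphicalArrangement.1 hy _ _ hadj) with h | h
  · exact absurd (hτR j k hadj.symm h) (not_lt.2 hkj.le)
  · rw [hj, ← hl] at hadj h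
    exact absurd (hσR l i hadj h) (not_lt.2 hil)

/-- For a permutation in the region, the closed region is described by the order of positions. -/
theorem mem_closure_orientationCone_iff (hy : y ∈ (graphicalArrangement G).compl)
    {σ : Equiv.Perm (Fin n)} (hσ : σ ∈ regionPerms (orientationCone G y))
    {x : EuclideanSpace ℝ (Fin n)} :
    x ∈ closure (orientationCone G y) ↔
      ∀ a b, G.Adj a b → σ.symm a < σ.symm b → x b ≤ x a := by
  rw [closure_orientationCone]
  rw [mem_regionPerms_orientationCone] at hσ
  have key : ∀ a b, G.Adj a b → (y b < y a ↔ σ.symm a < σ.symm b) := by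
    intro a b hab
    have h1 : ∀ a b, G.Adj a b → y b < y a → σ.symm a < σ.symm b := fun a b hab h =>
      hσ _ _ (by simpa using hab) (by simpa using h)
    refine ⟨h1 a b hab, fun h => ?_⟩
    by_contra hle
    have := mem_compl_graphicalArrangement.1 hy _ _ hab
    exact absurd (h1 b a hab.symm (lt_of_le_of_ne (not_lt.1 hle) this)) (not_lt.2 h.le)
  exact forall₂_congr fun a b => forall_congr' fun hab => by rw [key a b hab]

end Regions

/-! ### Blocks ending at right-to-left minima -/

section SuffixMin

variable {n : ℕ} (σ : Equiv.Perm (Fin n))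

/-- The smallest entry of `σ` at or to the right of the entry `a`. -/
def suffixMin (a : Fin n) : Fin n :=
  (Finset.univ.filter fun b => σ.symm a ≤ σ.symm b).min' ⟨a, by simp⟩

variable {σ}

theorem suffixMin_le_of_le {a b : Fin n} (h : σ.symm a ≤ σ.symm b) : suffixMin σ a ≤ b :=
  Finset.min'_le _ _ (by simpa using h)

theorem suffixMin_le (a : Fin n) : suffixMin σ a ≤ a := suffixMin_le_of_le le_rfl

theorem symm_le_symm_suffixMin (a : Fin n) : σ.symm a ≤ σ.symm (suffixMin σ a) := by
  have := Finset.min'_mem (Finset.univ.filter fun b => σ.symm a ≤ σ.symm b) ⟨a, by simp⟩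
  exact (Finset.mem_filter.1 this).2

theorem suffixMin_mono {a b : Fin n} (h : σ.symm a ≤ σ.symm b) :
    suffixMin σ a ≤ suffixMin σ b :=
  suffixMin_le_of_le (h.trans (symm_le_symm_suffixMin b))

@[simp]
theorem suffixMin_suffixMin (a : Fin n) : suffixMin σ (suffixMin σ a) = suffixMin σ a :=
  le_antisymm (suffixMin_le _) (suffixMin_mono (symm_le_symm_suffixMin a))

theorem suffixMin_apply_eq_self_iff (i : Fin n) :
    suffixMin σ (σ i) = σ i ↔ ∀ j, i < j → σ i < σ j := by
  constructor
  · intro h j hij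
    refine lt_of_le_of_ne ?_ fun e => hij.ne (σ.injective e)
    rw [← h]
    exact suffixMin_le_of_le (by simpa using hij.le)
  · intro h
    refine le_antisymm (suffixMin_le _) ?_
    have h1 := symm_le_symm_suffixMin (σ := σ) (σ i)
    rw [Equiv.symm_apply_apply] at h1
    rcases h1.eq_or_lt with e | hlt
    · exact ((Equiv.eq_symm_apply σ).1 e).le
    · simpa using (h _ hlt).le

variable (σ) in
theorem card_suffixMin_eq_self : Fintype.card {a // suffixMin σ a = a} = rlMin σ := by
  rw [Fintype.card_subtype, rlMin]
  symm
  refine Finset.card_bij (fun i _ => σ i) ?_ (fun _ _ _ _ h => σ.injective h) ?_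
  · intro i hi
    simpa [suffixMin_apply_eq_self_iff] using hi
  · intro a ha
    refine ⟨σ.symm a, ?_, by simp⟩
    have := suffixMin_apply_eq_self_iff (σ := σ) (σ.symm a)
    simp only [Equiv.apply_symm_apply] at this
    simpa [this] using ha

/-- An entry other than its suffix minimum has a smaller neighbour with the same suffix minimum
to its right. -/
theorem exists_adj_of_suffixMin_ne {G : SimpleGraph (Fin n)} (hG : IsNaturalUnitInterval G)
    (hσ : DescentsAreEdges G σ) {a : Fin n} (ha : suffixMin σ a ≠ a) :
    ∃ b, b < a ∧ G.Adj a b ∧ σ.symm a < σ.symm b ∧ suffixMin σ b = suffixMin σ a := by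
  have hlt : suffixMin σ a < a := lt_of_le_of_ne (suffixMin_le a) ha
  have hpos : σ.symm a < σ.symm (suffixMin σ a) :=
    lt_of_le_of_ne (symm_le_symm_suffixMin a) fun e => ha (σ.symm.injective e).symm
  obtain ⟨k, h1, h2, h3, h4⟩ := hσ.exists_adj_right hG hpos (by simpa using hlt)
  rw [Equiv.apply_symm_apply] at h3 h4
  refine ⟨σ k, h3, h4, by simpa using h1, le_antisymm ?_ (suffixMin_mono (by simpa using h1.le))⟩
  simpa using suffixMin_mono (σ := σ) (a := σ k) (b := suffixMin σ a) (by simpa using h2)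

variable {G : SimpleGraph (Fin n)} {x : EuclideanSpace ℝ (Fin n)}

/-- Follow smaller neighbours to the right inside the block; `x` weakly decreases along each such
edge. -/
theorem apply_suffixMin_le (hG : IsNaturalUnitInterval G) (hσ : DescentsAreEdges G σ)
    (hx : ∀ a b, G.Adj a b → σ.symm a < σ.symm b → x b ≤ x a) (a : Fin n) :
    x (suffixMin σ a) ≤ x a := by
  induction a using WellFoundedLT.induction with
  | ind a ih =>
    by_cases ha : suffixMin σ a = a
    · rw [ha]
    · obtain ⟨b, hba, hadj, hpos, he⟩ := exists_adj_of_suffixMin_ne hG hσ ha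
      rw [← he]
      exact (ih b hba).trans (hx a b hadj hpos)

theorem apply_suffixMin_eq (hG : IsNaturalUnitInterval G) (hσ : DescentsAreEdges G σ)
    (hx : ∀ a b, G.Adj a b → suffixMin σ a = suffixMin σ b → x a = x b) (a : Fin n) :
    x (suffixMin σ a) = x a := by
  induction a using WellFoundedLT.induction with
  | ind a ih =>
    by_cases ha : suffixMin σ a = a
    · rw [ha]
    · obtain ⟨b, hba, hadj, hpos, he⟩ := exists_adj_of_suffixMin_ne hG hσ ha
      rw [← he, hx a b hadj he.symm]
      exact ih b hba

end SuffixMin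

/-! ### Averages over fibres -/

section FibreAverage

variable {ι : Type*} [Fintype ι] [DecidableEq ι]

/-- The average of `v` over the fibre of `f` above `c`. -/
noncomputable def fibreAverage (f : ι → ι) (v : ι → ℝ) (c : ι) : ℝ :=
  (∑ b with f b = c, v b) / (Finset.univ.filter fun b => f b = c).card

theorem sum_sub_fibreAverage_mul (f : ι → ι) (v g : ι → ℝ) :
    ∑ a, (v a - fibreAverage f v (f a)) * g (f a) = 0 := by
  rw [← Finset.sum_fiberwise Finset.univ f]
  refine Finset.sum_eq_zero fun c _ => ?_
  have h : ∀ a ∈ Finset.univ.filter (fun b => f b = c),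
      (v a - fibreAverage f v (f a)) * g (f a) = (v a - fibreAverage f v c) * g c := by
    intro a ha
    rw [(Finset.mem_filter.1 ha).2]
  rw [Finset.sum_congr rfl h, ← Finset.sum_mul, Finset.sum_sub_distrib, Finset.sum_const,
    nsmul_eq_mul, fibreAverage]
  -- Over an empty fibre the average is a division by zero, but the sum is empty too.
  rcases Nat.eq_zero_or_pos (Finset.univ.filter fun b => f b = c).card with h0 | h0
  · rw [Finset.card_eq_zero] at h0
    simp [h0]
  · have : ((Finset.univ.filter fun b => f b = c).card : ℝ) ≠ 0 := by positivity
    rw [mul_div_cancel₀ _ this, sub_self, zero_mul]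

theorem div_card_le_fibreAverage {f : ι → ι} {v : ι → ℝ} (hv : ∀ a, 0 ≤ v a) (a : ι) :
    v a / Fintype.card ι ≤ fibreAverage f v (f a) := by
  have hmem : a ∈ Finset.univ.filter fun b => f b = f a := by simp
  have hcard : 0 < (Finset.univ.filter fun b => f b = f a).card := Finset.card_pos.2 ⟨a, hmem⟩
  exact div_le_div₀ (Finset.sum_nonneg fun b _ => hv b)
    (Finset.single_le_sum (f := v) (fun b _ => hv b) hmem) (by exact_mod_cast hcard)
    (by exact_mod_cast Finset.card_le_univ _)

theorem fibreAverage_le {f : ι → ι} {v : ι → ℝ} {M : ℝ} (a : ι)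
    (h : ∀ b, f b = f a → v b ≤ M) : fibreAverage f v (f a) ≤ M := by
  have hcard : 0 < (Finset.univ.filter fun b => f b = f a).card :=
    Finset.card_pos.2 ⟨a, by simp⟩
  rw [fibreAverage, div_le_iff₀ (by exact_mod_cast hcard)]
  have := Finset.sum_le_card_nsmul (Finset.univ.filter fun b => f b = f a) v M
    fun b hb => h b (Finset.mem_filter.1 hb).2
  rw [nsmul_eq_mul] at this
  linarith

end FibreAverage

theorem IsRapidlyDecreasing.pos {n : ℕ} {v : EuclideanSpace ℝ (Fin n)}
    (hv : IsRapidlyDecreasing v) (i : Fin n) : 0 < v i := by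
  induction i using WellFoundedGT.induction with
  | ind i ih =>
    by_cases h : (i : ℕ) + 1 = n
    · exact hv.2 i h
    · let j : Fin n := ⟨i + 1, by omega⟩
      have := hv.1 i j rfl
      have := ih j (Fin.lt_def.2 (Nat.lt_succ_self _))
      have : 0 < (6 * (n : ℝ) ^ 2 + 1) * v j := by positivity
      linarith

/-- Besides positivity, this factor `n` is all that the projection argument needs from the growth
condition. -/
theorem IsRapidlyDecreasing.mul_lt {n : ℕ} {v : EuclideanSpace ℝ (Fin n)}
    (hv : IsRapidlyDecreasing v) {i j : Fin n} (hij : i < j) : n * v j < v i := by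
  have hn : (1 : ℝ) ≤ n := by exact_mod_cast i.pos
  have hc : (n : ℝ) ≤ 6 * (n : ℝ) ^ 2 + 1 := by nlinarith
  induction i using WellFoundedGT.induction with
  | ind i ih =>
    have hij' : (i : ℕ) < j := hij
    let k : Fin n := ⟨i + 1, by omega⟩
    have hik : i < k := Fin.lt_def.2 (Nat.lt_succ_self _)
    have h1 := hv.1 i k rfl
    have hk := hv.pos k
    have h2 : (n : ℝ) * v k ≤ (6 * (n : ℝ) ^ 2 + 1) * v k :=
      mul_le_mul_of_nonneg_right hc hk.le
    rcases (show k ≤ j from Fin.le_def.2 hij').eq_or_lt with e | hlt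
    · rw [← e]
      linarith
    · have := ih k hik hlt
      nlinarith

/-! ### Relative interiors, invariant subspaces and nearest points -/

section Geometry

variable {n : ℕ}

/-- The subspace of the vectors `x` with `x ∘ f = x`. -/
def invariantSubspace (f : Fin n → Fin n) : Submodule ℝ (EuclideanSpace ℝ (Fin n)) where
  carrier := {x | ∀ a, x (f a) = x a}
  add_mem' hx hy a := by simp [hx a, hy a]
  zero_mem' a := rfl
  smul_mem' c x hx a := by simp [hx a]

theorem mem_invariantSubspace {f : Fin n → Fin n} {x : EuclideanSpace ℝ (Fin n)} :
    x ∈ invariantSubspace f ↔ ∀ a, x (f a) = x a := Iff.rfl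

theorem finrank_invariantSubspace {f : Fin n → Fin n} (hf : ∀ a, f (f a) = f a) :
    Module.finrank ℝ (invariantSubspace f) = Fintype.card {a // f a = a} := by
  let e : invariantSubspace f ≃ₗ[ℝ] ({a // f a = a} → ℝ) :=
    { toFun := fun x a => x.1 a.1
      map_add' := fun _ _ => rfl
      map_smul' := fun _ _ => rfl
      invFun := fun g => ⟨WithLp.toLp 2 fun a => g ⟨f a, hf a⟩, fun a => by simp [hf]⟩
      left_inv := fun x => by
        ext a
        exact x.2 a
      right_inv := fun g => by
        ext a
        simp [a.2] }
  rw [e.finrank_eq, Module.finrank_fintype_fun_eq_card]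

/-- A segment ending at a relative interior point can be prolonged beyond it. This forces uniqueness
of the face. -/
theorem exists_pos_add_smul_sub_mem {E : Type*} [NormedAddCommGroup E] [NormedSpace ℝ E]
    {F : Set E} {p x : E} (hp : p ∈ intrinsicInterior ℝ F) (hx : x ∈ F) :
    ∃ t : ℝ, 0 < t ∧ p + t • (p - x) ∈ F := by
  obtain ⟨q, hq, rfl⟩ := mem_intrinsicInterior.1 hp
  have hmem : ∀ t : ℝ, (q : E) + t • ((q : E) - x) ∈ affineSpan ℝ F := by
    intro t
    have := AffineSubspace.vadd_mem_of_mem_direction (Submodule.smul_mem _ t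
      (AffineSubspace.vsub_mem_direction q.2 (subset_affineSpan ℝ F hx))) q.2
    simpa [add_comm] using this
  have hc : Continuous fun t : ℝ => (⟨_, hmem t⟩ : affineSpan ℝ F) :=
    Continuous.subtype_mk (by fun_prop) _
  have h0 : (⟨_, hmem 0⟩ : affineSpan ℝ F) = q := Subtype.ext (by simp)
  have hev : ∀ᶠ t in nhds (0 : ℝ), (⟨_, hmem t⟩ : affineSpan ℝ F) ∈
      ((↑) : affineSpan ℝ F → E) ⁻¹' F :=
    hc.continuousAt.eventually (by beta_reduce; rw [h0]; exact mem_interior_iff_mem_nhds.1 hq)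
  obtain ⟨t, ht, h⟩ := ((hev.filter_mono nhdsWithin_le_nhds).and
    (self_mem_nhdsWithin : Set.Ioi (0 : ℝ) ∈ nhdsWithin 0 (Set.Ioi 0))).exists
  exact ⟨t, h, ht⟩

/-- A set that fills a neighbourhood of `p` in a subspace containing it has `p` in its relative
interior and spans that subspace. -/
theorem mem_intrinsicInterior_and_vectorSpan_eq {E : Type*} [NormedAddCommGroup E]
    [NormedSpace ℝ E] {F U : Set E} {W : Submodule ℝ E} {p : E} (hFW : F ⊆ W) (hU : IsOpen U)
    (hpU : p ∈ U) (hpW : p ∈ W) (hUF : U ∩ W ⊆ F) :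
    p ∈ intrinsicInterior ℝ F ∧ vectorSpan ℝ F = W := by
  have hpF : p ∈ F := hUF ⟨hpU, hpW⟩
  have hle : affineSpan ℝ F ≤ W.toAffineSubspace := affineSpan_le.2 hFW
  constructor
  · refine mem_intrinsicInterior.2 ⟨⟨p, subset_affineSpan ℝ F hpF⟩, ?_, rfl⟩
    refine mem_interior.2 ⟨((↑) : affineSpan ℝ F → E) ⁻¹' U, fun x hx => hUF ⟨hx, hle x.2⟩,
      hU.preimage continuous_subtype_val, hpU⟩
  · refine le_antisymm ?_ fun w hw => ?_
    · refine Submodule.span_le.2 ?_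
      rintro _ ⟨a, ha, b, hb, rfl⟩
      exact W.sub_mem (hFW ha) (hFW hb)
    · have hc : Continuous fun t : ℝ => p + t • w := by fun_prop
      have hev : ∀ᶠ t in nhds (0 : ℝ), p + t • w ∈ U :=
        hc.continuousAt.eventually (hU.mem_nhds (by simpa using hpU))
      obtain ⟨t, ht, h⟩ := ((hev.filter_mono nhdsWithin_le_nhds).and
        (self_mem_nhdsWithin : Set.Ioi (0 : ℝ) ∈ nhdsWithin 0 (Set.Ioi 0))).exists
      have htF : p + t • w ∈ F := hUF ⟨ht, W.add_mem hpW (W.smul_mem t hw)⟩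
      have := vsub_mem_vectorSpan ℝ htF hpF
      rw [vsub_eq_sub, add_sub_cancel_left] at this
      exact ((vectorSpan ℝ F).smul_mem_iff (ne_of_gt h)).1 this

theorem EuclideanSpace.dist_sq_eq_sum (x z : EuclideanSpace ℝ (Fin n)) :
    dist x z ^ 2 = ∑ i, (x i - z i) ^ 2 := by
  rw [EuclideanSpace.dist_eq, Real.sq_sqrt (Finset.sum_nonneg fun i _ => sq_nonneg _)]
  simp [Real.dist_eq, sq_abs]

/-- The variational inequality implies Pythagoras' inequality. -/
theorem dist_sq_add_dist_sq_le {v p q : EuclideanSpace ℝ (Fin n)}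
    (h : 0 ≤ ∑ a, (v a - p a) * (p a - q a)) : dist v p ^ 2 + dist p q ^ 2 ≤ dist v q ^ 2 := by
  simp only [EuclideanSpace.dist_sq_eq_sum]
  have : ∑ a, (v a - q a) ^ 2 = (∑ a, (v a - p a) ^ 2 + ∑ a, (p a - q a) ^ 2) +
      2 * ∑ a, (v a - p a) * (p a - q a) := by
    rw [Finset.mul_sum, ← Finset.sum_add_distrib, ← Finset.sum_add_distrib]
    exact Finset.sum_congr rfl fun a _ => by ring
  linarith

end Geometry

/-! ### The projection of `v` and its face -/

section Projection

variable {n : ℕ} {G : SimpleGraph (Fin n)} {σ : Equiv.Perm (Fin n)}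

/-- The average of `v` over the block of `σ` ending in the suffix minimum of each entry. -/
noncomputable def blockAverage (σ : Equiv.Perm (Fin n)) (v : EuclideanSpace ℝ (Fin n)) :
    EuclideanSpace ℝ (Fin n) :=
  WithLp.toLp 2 fun a => fibreAverage (suffixMin σ) v (suffixMin σ a)

theorem blockAverage_apply (σ : Equiv.Perm (Fin n)) (v : EuclideanSpace ℝ (Fin n)) (a : Fin n) :
    blockAverage σ v a = fibreAverage (suffixMin σ) v (suffixMin σ a) := rfl

theorem lt_div_card_of_lt {v : EuclideanSpace ℝ (Fin n)} (hv : IsRapidlyDecreasing v)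
    {i j : Fin n} (hij : i < j) : v j < v i / Fintype.card (Fin n) := by
  have hn : (0 : ℝ) < n := by exact_mod_cast i.pos
  rw [Fintype.card_fin, lt_div_iff₀ hn, mul_comm]
  exact hv.mul_lt hij

theorem div_card_le_blockAverage {v : EuclideanSpace ℝ (Fin n)} (hv : IsRapidlyDecreasing v)
    (a : Fin n) : v (suffixMin σ a) / Fintype.card (Fin n) ≤ blockAverage σ v a := by
  have := div_card_le_fibreAverage (f := suffixMin σ) (v := v) (fun a => (hv.pos a).le)
    (suffixMin σ a)
  rwa [suffixMin_suffixMin] at this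

/-- An average is at most `v` at the block minimum and at least that value divided by `n`; the drop
of `v` separates these bounds. -/
theorem blockAverage_lt {v : EuclideanSpace ℝ (Fin n)} (hv : IsRapidlyDecreasing v)
    {a b : Fin n} (h : suffixMin σ a < suffixMin σ b) :
    blockAverage σ v b < blockAverage σ v a := by
  refine lt_of_le_of_lt (fibreAverage_le (M := v (suffixMin σ b)) b fun c hc => ?_)
    ((lt_div_card_of_lt hv h).trans_le (div_card_le_blockAverage hv a))
  rw [← hc]
  rcases (suffixMin_le (σ := σ) c).eq_or_lt with e | hlt
  · rw [e]
  · have h1 := hv.mul_lt hlt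
    have h2 := hv.pos c
    have hn : (1 : ℝ) ≤ n := by exact_mod_cast c.pos
    nlinarith

theorem blockAverage_eq_iff {v : EuclideanSpace ℝ (Fin n)} (hv : IsRapidlyDecreasing v)
    {a b : Fin n} : blockAverage σ v a = blockAverage σ v b ↔ suffixMin σ a = suffixMin σ b := by
  constructor
  · intro h
    rcases lt_trichotomy (suffixMin σ a) (suffixMin σ b) with h' | h' | h'
    · exact absurd h (blockAverage_lt hv h').ne'
    · exact h'
    · exact absurd h (blockAverage_lt hv h').ne
  · intro h
    rw [blockAverage_apply, blockAverage_apply, h]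

theorem sum_sub_blockAverage_nonneg (hG : IsNaturalUnitInterval G) (hσ : DescentsAreEdges G σ)
    {v q : EuclideanSpace ℝ (Fin n)} (hv : IsRapidlyDecreasing v)
    (hq : ∀ a b, G.Adj a b → σ.symm a < σ.symm b → q b ≤ q a) :
    0 ≤ ∑ a, (v a - blockAverage σ v a) * (blockAverage σ v a - q a) := by
  have h1 := sum_sub_fibreAverage_mul (suffixMin σ) v
    (fun c => fibreAverage (suffixMin σ) v c - q c)
  simp only [← blockAverage_apply] at h1
  rw [← h1]
  -- With `q` replaced by its value at the block minimum the sum vanishes. The correction is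
  -- termwise nonnegative: off the minimum, `v a` is below the average and `q a` is at least the
  -- value at the minimum.
  refine Finset.sum_le_sum fun a _ => ?_
  have h2 := apply_suffixMin_le hG hσ hq a
  rcases (suffixMin_le (σ := σ) a).eq_or_lt with e | hlt
  · rw [e]
  · have h3 := (lt_div_card_of_lt hv hlt).trans_le (div_card_le_blockAverage (σ := σ) hv a)
    have h4 : fibreAverage (suffixMin σ) v (suffixMin σ a) = blockAverage σ v a := rfl
    nlinarith

theorem hasProjDim_orientationCone (hG : IsNaturalUnitInterval G)
    {y : EuclideanSpace ℝ (Fin n)} (hy : y ∈ (graphicalArrangement G).compl)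
    (hσR : σ ∈ regionPerms (orientationCone G y)) (hσ : DescentsAreEdges G σ)
    {v : EuclideanSpace ℝ (Fin n)} (hv : IsRapidlyDecreasing v) :
    HasProjDim (graphicalArrangement G) v (orientationCone G y) (rlMin σ) := by
  have hcl {x} := mem_closure_orientationCone_iff (x := x) hy hσR
  set C := closure (orientationCone G y) with hC
  set p := blockAverage σ v with hp
  set W := invariantSubspace (suffixMin σ) with hW
  have hpW : p ∈ W := mem_invariantSubspace.2 fun a =>
    (blockAverage_eq_iff hv).2 (suffixMin_suffixMin a)
  -- Inside `W`, this open condition alone implies membership in `C`, so `C ∩ W` fills a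
  -- neighbourhood of `p` in `W`.
  let U : Set (EuclideanSpace ℝ (Fin n)) :=
    {x | ∀ a b, suffixMin σ a < suffixMin σ b → x b < x a}
  have hU : IsOpen U := by
    simp only [U, Set.ofPred_forall]
    refine isOpen_iInter_of_finite fun a => isOpen_iInter_of_finite fun b =>
      isOpen_iInter_of_finite fun _ => isOpen_lt (by fun_prop) (by fun_prop)
  have hpU : p ∈ U := fun a b h => blockAverage_lt hv h
  have hUW : U ∩ W ⊆ C := by
    rintro x ⟨hxU, hxW⟩
    refine hcl.2 fun a b _ hlt => ?_
    rcases (suffixMin_mono hlt.le).eq_or_lt with e | h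
    · rw [← hxW a, ← hxW b, e]
    · exact (hxU a b h).le
  have hpC : p ∈ C := hUW ⟨hpU, hpW⟩
  have hpyth : ∀ q ∈ C, dist v p ^ 2 + dist p q ^ 2 ≤ dist v q ^ 2 := fun q hq =>
    dist_sq_add_dist_sq_le (sum_sub_blockAverage_nonneg hG hσ hv (hcl.1 hq))
  have hnear : IsNearestPoint v (orientationCone G y) p :=
    ⟨hpC, fun q hq => le_of_sq_le_sq (by nlinarith [hpyth q hq, sq_nonneg (dist p q)])
      dist_nonneg⟩
  have hsInf : ∀ (B : Set (AffineSubspace ℝ (EuclideanSpace ℝ (Fin n)))) x,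
      x ∈ ((sInf B : AffineSubspace ℝ (EuclideanSpace ℝ (Fin n))) :
        Set (EuclideanSpace ℝ (Fin n))) ↔ ∀ H ∈ B, x ∈ H := by
    intro B x
    rw [AffineSubspace.coe_sInf]
    simp
  -- All hyperplanes through `p`: they cut out the smallest flat containing it, which is `W`.
  let B : Set (AffineSubspace ℝ (EuclideanSpace ℝ (Fin n))) :=
    {H | H ∈ graphicalArrangement G ∧ p ∈ H}
  have hB : ∀ x, (∀ H ∈ B, x ∈ H) ↔ x ∈ W := by
    intro x
    constructor
    · intro h
      have h' : ∀ a b, G.Adj a b → suffixMin σ a = suffixMin σ b → x a = x b := by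
        have aux : ∀ a b, a < b → G.Adj a b → suffixMin σ a = suffixMin σ b → x a = x b := by
          intro a b hab hadj he
          refine sub_eq_zero.1 ((mem_coordHyperplane a b x).1
            (h _ ⟨⟨a, b, hab, hadj, rfl⟩, (mem_coordHyperplane a b p).2 ?_⟩))
          exact sub_eq_zero.2 ((blockAverage_eq_iff hv).2 he)
        intro a b hadj he
        rcases lt_or_gt_of_ne hadj.ne with hlt | hlt
        · exact aux a b hlt hadj he
        · exact (aux b a hlt hadj.symm he.symm).symm
      exact mem_invariantSubspace.2 (apply_suffixMin_eq hG hσ h')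
    · rintro hx _ ⟨⟨i, j, -, -, rfl⟩, hpH⟩
      rw [mem_coordHyperplane, sub_eq_zero] at hpH ⊢
      rw [← hx i, ← hx j, (blockAverage_eq_iff hv).1 hpH]
  have hF : (graphicalArrangement G).IsFaceOf (orientationCone G y) (C ∩ W) := by
    refine ⟨⟨p, hpC, hpW⟩, B, fun H hH => hH.1, ?_⟩
    ext x
    exact and_congr_right fun _ => ((hsInf B x).trans (hB x)).symm
  obtain ⟨hpI, hspan⟩ := mem_intrinsicInterior_and_vectorSpan_eq (F := C ∩ W)
    Set.inter_subset_right hU hpU hpW fun x hx => ⟨hUW hx, hx.2⟩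
  refine ⟨p, hnear, fun q hq => ?_, C ∩ W, ⟨hF, hpI⟩, ?_, ?_⟩
  · have h1 := hpyth q hq.1
    have h2 := pow_le_pow_left₀ dist_nonneg (hq.2 p hpC) 2
    have h3 : dist p q ^ 2 = 0 := le_antisymm (by linarith) (sq_nonneg _)
    exact (dist_eq_zero.1 (pow_eq_zero_iff two_ne_zero |>.1 h3)).symm
  · rintro F' ⟨⟨-, B', hB'A, rfl⟩, hpF'⟩
    have hpB' := (hsInf B' p).1 (intrinsicInterior_subset hpF').2
    ext x
    refine and_congr_right fun hxC => ⟨fun hx => (hB x).1 ?_, fun hx => (hsInf B' x).2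
      fun H hH => (hB x).2 hx H ⟨hB'A hH, hpB' H hH⟩⟩
    -- An edge inequality tight at `p` holds both at `x` and beyond `p` on the line from `x`, hence
    -- is tight at `x`.
    obtain ⟨t, ht, hmem⟩ := exists_pos_add_smul_sub_mem hpF' ⟨hxC, hx⟩
    have key : ∀ a b, G.Adj a b → σ.symm a < σ.symm b → p a = p b → x a = x b := by
      intro a b hadj hlt he
      have h1 := hcl.1 hxC a b hadj hlt
      have h2 := hcl.1 hmem.1 a b hadj hlt
      simp only [PiLp.add_apply, PiLp.smul_apply, PiLp.sub_apply, smul_eq_mul, he] at h2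
      have h3 : x a ≤ x b := le_of_mul_le_mul_left (by linarith) ht
      exact le_antisymm h3 h1
    rintro _ ⟨⟨i, j, -, hadj, rfl⟩, hpH⟩
    rw [mem_coordHyperplane, sub_eq_zero] at hpH ⊢
    rcases lt_or_gt_of_ne (fun e => hadj.ne (σ.symm.injective e)) with hlt | hlt
    · exact key i j hadj hlt hpH
    · exact (key j i hadj.symm hlt hpH.symm).symm
  · rw [affineDim, direction_affineSpan, hspan, finrank_invariantSubspace suffixMin_suffixMin,
      card_suffixMin_eq_self]

end Projection

theorem theorem5 {n : ℕ} (G : SimpleGraph (Fin n)) (hG : IsNaturalUnitInterval G)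
    (R : Set (EuclideanSpace ℝ (Fin n))) (hR : (graphicalArrangement G).IsRegion R) :
    ∃ σ : Equiv.Perm (Fin n),
      IsLexMin (regionPerms R) σ ∧
      (∀ τ : Equiv.Perm (Fin n), τ ∈ regionPerms R ∧ DescentsAreEdges G τ ↔ τ = σ) ∧
      ∀ v : EuclideanSpace ℝ (Fin n), IsRapidlyDecreasing v →
        HasProjDim (graphicalArrangement G) v R (rlMin σ) := by
  obtain ⟨y, hy, rfl⟩ := hR
  rw [connectedComponentIn_compl_graphicalArrangement hy]
  obtain ⟨σ, hσ, hmin⟩ := Set.exists_min_image (regionPerms (orientationCone G y))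
    (fun τ => toLex (τ : Fin n → Fin n)) (Set.toFinite _)
    (regionPerms_orientationCone_nonempty G y)
  have hlex : IsLexMin (regionPerms (orientationCone G y)) σ := ⟨hσ, hmin⟩
  have hdesc := hlex.descentsAreEdges
  refine ⟨σ, hlex, fun τ => ⟨fun ⟨hτ, hτd⟩ => ?_, ?_⟩, fun v hv =>
    hasProjDim_orientationCone hG hy hσ hdesc hv⟩
  · exact DFunLike.coe_injective (toLex.injective
      (le_antisymm (hτd.toLex_le hG hy hτ hσ) (hmin τ hτ)))
  · rintro rfl
    exact ⟨hσ, hdesc⟩
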